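/- A simplicial complex on vertices in $[n]=\{1,\dots,n\}$ is a downward-closed family $\Delta$ of subsets of $[n]$; a graph on $[n]$ is regarded as the complex whose faces are $\emptyset$, all singletons $\{v\}$, and all edges. A finite set $P\subseteq\mathbb{R}^{d}$ is in general position if, for every $k\le d+1$, no $k$ points of $P$ lie on a common $(k-2)$-dimensional affine subspace. The complex $\Delta$ is partition induced on a finite set $P\subseteq\mathbb{R}^d$ if $P$ is a union of pairwise disjoint sets $P_1,\dots,P_n$ such that for every $\sigma\subseteq[n]$ we have $\sigma\in\Delta$ if and only if $\bigcap_{i\in\sigma}\operatorname{conv}(P_i)\neq\emptyset$ (the intersection over $\sigma=\emptyset$ being $\mathbb{R}^d$). It is $d$-Tverberg if there is a constant $C$ such that $\Delta$ is partition induced on every finite $P\subseteq\mathbb{R}^d$ in general position with $|P|\ge C$, and weakly $d$-Tverberg if there is a constant $C$ such that every finite $P\subseteq\mathbb{R}^d$ in general position with $|P|\ge C$ has a subset on which $\Delta$ is partition induced. **Theorem.** For every integer $d\ge 1$ there is a finite graph $G$ such that, for every integer $d'$ with $1\le d'\le d$, the graph $G$ is neither $d'$-Tverberg nor weakly $d'$-Tverberg.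 -/

import Mathlib

/-- `ℝ^d` with its Euclidean structure. -/
abbrev Pt (d : ℕ) : Type := EuclideanSpace ℝ (Fin d)

/-- A simplicial complex on vertices in `[n]`: a downward-closed system of subsets of `[n]`
(not every element of `[n]` has to be a vertex). -/
abbrev SetComplex (n : ℕ) : Type := LowerSet (Finset (Fin n))

/-- A graph as a simplicial complex: the faces are the empty set, all vertices (singletons),
and all edges, that is, the sets of at most two pairwise adjacent vertices. -/
def graphComplex {n : ℕ} (G : SimpleGraph (Fin n)) : SetComplex n where
  carrier := {σ | σ.card ≤ 2 ∧ G.IsClique (σ : Set (Fin n))}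
  lower' := fun _ _ hτσ hσ =>
    ⟨(Finset.card_le_card hτσ).trans hσ.1, hσ.2.subset (Finset.coe_subset.mpr hτσ)⟩

/-- A finite point set in `ℝ^d` is in general position if, for every `k ≤ d + 1`, no `k` of its
points lie on a common `(k - 2)`-dimensional affine subspace. -/
def InGeneralPosition {d : ℕ} (P : Finset (Pt d)) : Prop :=
  ∀ k : ℕ, k ≤ d + 1 → ∀ S ⊆ P, S.card = k →
    ¬ ∃ L : AffineSubspace ℝ (Pt d),
      Module.finrank ℝ L.direction + 2 = k ∧ (S : Set (Pt d)) ⊆ (L : Set (Pt d))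

/-- `Δ` is partition induced on `P`: `P` splits into pairwise disjoint parts `P₁, …, Pₙ` such that
`Δ` is the nerve of their convex hulls. (The intersection over `σ = ∅` is all of `ℝ^d`.) -/
def IsPartitionInduced {n d : ℕ} (Δ : SetComplex n) (P : Finset (Pt d)) : Prop :=
  ∃ Q : Fin n → Finset (Pt d),
    (∀ i j, i ≠ j → Disjoint (Q i) (Q j)) ∧
    (∀ x, x ∈ P ↔ ∃ i, x ∈ Q i) ∧
    ∀ σ : Finset (Fin n),
      σ ∈ Δ ↔ (⋂ i ∈ σ, convexHull ℝ (Q i : Set (Pt d))).Nonempty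

/-- `Δ` is `d`-Tverberg: it is partition induced on every sufficiently large finite point set in
general position in `ℝ^d`. -/
def IsTverberg {n : ℕ} (d : ℕ) (Δ : SetComplex n) : Prop :=
  ∃ C : ℕ, ∀ P : Finset (Pt d), InGeneralPosition P → C ≤ P.card → IsPartitionInduced Δ P

/-- `Δ` is weakly `d`-Tverberg: it is partition induced on some subset of every sufficiently large
finite point set in general position in `ℝ^d`. -/
def IsWeaklyTverberg {n : ℕ} (d : ℕ) (Δ : SetComplex n) : Prop :=
  ∃ C : ℕ, ∀ P : Finset (Pt d), InGeneralPosition P → C ≤ P.card →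
    ∃ P' ⊆ P, IsPartitionInduced Δ P'

/-! Place the points on the moment curve. A linear functional restricted to the curve is a
polynomial in the parameter, so the hulls of two parts are disjoint exactly when a polynomial of
degree at most `d'` separates the parameter sets (`not_inter_convexHull_nonempty_iff_polySep`). A
graph induced on such points is therefore an intersection pattern of finite sets of reals modulo
`PolySep`; only the pairs of parts matter.

The incidence graph of elements and subsets of `Fin m` is not such a pattern for large `m`
(`two_pow_le_of_incidence`). The element sets are pairwise separated, so polynomially many cells of
the line keep them apart. Separability is decided by the length of alternation
(`altChain_or_polySep`), hence by the cells that are met. Each subset is then recovered from two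
sets of at most `e + 2` cells, which leaves only polynomially many codes in `m` for `2 ^ m` subsets.
-/

/-! ### Polynomial separation and alternation on the line. -/

open Polynomial in
/-- Two finite sets of reals are separated by the signs of a polynomial of degree at most `e`. -/
def PolySep (e : ℕ) (S R : Finset ℝ) : Prop :=
  ∃ p : ℝ[X], p.natDegree ≤ e ∧ (∀ x ∈ S, 0 < p.eval x) ∧ ∀ x ∈ R, p.eval x < 0

/-- There is a decreasing chain of `k` reals, alternately in `S` and `R`, the largest in `S`. -/
def AltChain (k : ℕ) (S R : Finset ℝ) : Prop :=
  ∃ x : ℕ → ℝ, (∀ i, i + 1 < k → x (i + 1) < x i) ∧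
    ∀ i, i < k → x i ∈ if Even i then S else R

theorem PolySep.symm {e : ℕ} {S R : Finset ℝ} (h : PolySep e S R) : PolySep e R S := by
  obtain ⟨p, h1, h2, h3⟩ := h
  refine ⟨-p, by simpa using h1, fun x hx => ?_, fun x hx => ?_⟩
  · simpa using h3 x hx
  · simpa using h2 x hx

theorem exists_root_between {p : Polynomial ℝ} {x y : ℝ} (hxy : x < y)
    (h : p.eval x * p.eval y < 0) : ∃ z, x < z ∧ z < y ∧ p.IsRoot z := by
  have hc : ContinuousOn (fun t => p.eval t) (Set.Icc x y) := p.continuous.continuousOn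
  rcases mul_neg_iff.mp h with ⟨h1, h2⟩ | ⟨h1, h2⟩
  · obtain ⟨z, hz, hz0⟩ := intermediate_value_Ioo' hxy.le hc ⟨h2, h1⟩
    exact ⟨z, hz.1, hz.2, hz0⟩
  · obtain ⟨z, hz, hz0⟩ := intermediate_value_Ioo hxy.le hc ⟨h1, h2⟩
    exact ⟨z, hz.1, hz.2, hz0⟩

/-- The `e + 2` alternating points force `e + 1` sign changes, hence more roots than the degree
allows. -/
theorem AltChain.not_polySep {e : ℕ} {S R : Finset ℝ} (h : AltChain (e + 2) S R) :
    ¬ PolySep e S R := by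
  rintro ⟨p, hdeg, hS, hR⟩
  obtain ⟨x, hx, hmem⟩ := h
  have hp : p ≠ 0 := by
    rintro rfl
    simpa using hS (x 0) (by simpa using hmem 0 (by omega))
  have hroot : ∀ i : Fin (e + 1), ∃ z, x (i + 1) < z ∧ z < x i ∧ p.IsRoot z := by
    intro i
    have hi := i.2
    refine exists_root_between (hx i (by omega)) ?_
    have h1 := hmem i (by omega)
    have h2 := hmem (i + 1) (by omega)
    by_cases hev : Even (i : ℕ)
    · rw [if_pos hev] at h1
      rw [if_neg (by simpa [Nat.even_add_one] using hev)] at h2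
      exact mul_neg_of_neg_of_pos (hR _ h2) (hS _ h1)
    · rw [if_neg hev] at h1
      rw [if_pos (by simpa [Nat.even_add_one] using hev)] at h2
      exact mul_neg_of_pos_of_neg (hS _ h2) (hR _ h1)
  choose z hz1 hz2 hz3 using hroot
  have hanti : StrictAnti z := by
    refine Fin.strictAnti_iff_succ_lt.mpr fun i => ?_
    have h1 := hz2 i.succ
    have h2 := hz1 i.castSucc
    simp only [Fin.val_succ, Fin.val_castSucc] at h1 h2
    exact h1.trans h2
  have hcard : (Finset.univ.image z).card ≤ p.roots.toFinset.card := by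
    refine Finset.card_le_card fun y hy => ?_
    obtain ⟨i, -, rfl⟩ := Finset.mem_image.mp hy
    simpa [hp] using hz3 i
  rw [Finset.card_image_of_injective _ hanti.injective, Finset.card_fin] at hcard
  have := (Multiset.toFinset_card_le p.roots).trans (p.card_roots'.trans hdeg)
  omega

/-- The chain lies entirely below `s`, so points of `S'` at or above `s` do no harm and need not
belong to `S`. -/
theorem AltChain.cons {k : ℕ} {S S' R R' : Finset ℝ} {s : ℝ} (hs : s ∈ S) (hR : R' ⊆ R)
    (hlt : ∀ r ∈ R', r < s) (hS : ∀ y ∈ S', y < s → y ∈ S) (h : AltChain k R' S') :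
    AltChain (k + 1) S R := by
  obtain ⟨x, hx, hmem⟩ := h
  have hxs : ∀ i, i < k → x i < s := by
    intro i
    induction i with
    | zero => exact fun hi => hlt _ (by simpa using hmem 0 hi)
    | succ i ih => exact fun hi => (hx i hi).trans (ih (by omega))
  refine ⟨fun i => Nat.casesOn i s x, fun i hi => ?_, fun i hi => ?_⟩
  · cases i with
    | zero => exact hxs 0 (by omega)
    | succ i => exact hx i (by omega)
  · cases i with
    | zero => simpa using hs
    | succ i =>
      have := hmem i (by omega)
      by_cases hev : Even i
      · rw [if_pos hev] at this
        rw [if_neg (by simpa [Nat.even_add_one] using hev)]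
        exact hR this
      · rw [if_neg hev] at this
        rw [if_pos (by simpa [Nat.even_add_one] using hev)]
        exact hS _ this (hxs i (by omega))

theorem polySep_empty_left (e : ℕ) (R : Finset ℝ) : PolySep e ∅ R :=
  ⟨-1, by simp, by simp, by simp⟩

/-- Induction on the degree. All of `S` lies at or below its maximum `s`, so a linear factor with
root just above `s` flips the sign there and keeps it on the part of `R` above `s`. It remains to
separate the part of `R` below `s` from everything else in one degree less, and a chain obstructing
that extends by `s`. -/
theorem polySep_of_not_altChain_succ (k : ℕ) : ∀ S R : Finset ℝ, Disjoint S R →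
    ¬ AltChain (k + 1) S R → PolySep k S R := by
  induction k with
  | zero =>
    intro S R _ h
    rcases S.eq_empty_or_nonempty with rfl | ⟨s, hs⟩
    · exact polySep_empty_left _ _
    · exact absurd ⟨fun _ => s, fun i hi => by omega, fun i hi => by
        obtain rfl : i = 0 := by omega
        simpa using hs⟩ h
  | succ k ih =>
    intro S R hd h
    rcases S.eq_empty_or_nonempty with rfl | hS
    · exact polySep_empty_left _ _
    set s := S.max' hS with hs
    have hsS : s ∈ S := S.max'_mem hS
    have hsep : PolySep k (R.filter (· < s)) (S ∪ R.filter (s < ·)) := by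
      refine ih _ _ ?_ fun hc => h ?_
      · rw [Finset.disjoint_union_right]
        refine ⟨hd.symm.mono_left (Finset.filter_subset _ _), ?_⟩
        rw [Finset.disjoint_filter]
        exact fun x _ h1 h2 => lt_asymm h1 h2
      · refine hc.cons hsS (Finset.filter_subset _ _)
          (fun r hr => (Finset.mem_filter.mp hr).2) fun y hy hys => ?_
        rcases Finset.mem_union.mp hy with hy | hy
        · exact hy
        · exact absurd hys (lt_asymm (Finset.mem_filter.mp hy).2)
    obtain ⟨p, hdeg, hpR, hpS⟩ := hsep
    obtain ⟨c, hsc, hcR⟩ : ∃ c, s < c ∧ ∀ r ∈ R, s < r → c < r := by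
      rcases (R.filter (s < ·)).eq_empty_or_nonempty with he | hne
      · refine ⟨s + 1, by linarith, fun r hr hsr => ?_⟩
        exact absurd (Finset.mem_filter.mpr ⟨hr, hsr⟩) (by simp [he])
      · have hm := (Finset.mem_filter.mp (Finset.min'_mem _ hne)).2
        obtain ⟨c, h1, h2⟩ := exists_between hm
        exact ⟨c, h1, fun r hr hsr =>
          h2.trans_le (Finset.min'_le _ _ (Finset.mem_filter.mpr ⟨hr, hsr⟩))⟩
    refine ⟨p * (Polynomial.X - Polynomial.C c), ?_, fun x hx => ?_, fun x hx => ?_⟩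
    · exact Polynomial.natDegree_mul_le.trans (by rw [Polynomial.natDegree_X_sub_C]; omega)
    · have h1 := hpS x (Finset.mem_union_left _ hx)
      have h2 : x ≤ s := S.le_max' x hx
      simpa using mul_pos_of_neg_of_neg h1 (by linarith : x - c < 0)
    · have hne : x ≠ s := fun hxs => Finset.disjoint_left.mp hd (hxs ▸ hsS) hx
      rcases lt_or_gt_of_ne hne with hxs | hxs
      · have h1 := hpR x (Finset.mem_filter.mpr ⟨hx, hxs⟩)
        simpa using mul_neg_of_pos_of_neg h1 (by linarith : x - c < 0)
      · have h1 := hpS x (Finset.mem_union_right _ (Finset.mem_filter.mpr ⟨hx, hxs⟩))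
        have h2 := hcR x hx hxs
        simpa using mul_neg_of_neg_of_pos h1 (by linarith : 0 < x - c)

/-- If chains of length `e + 1` start on both sides, the larger of the two maxima can be put in
front of the chain starting on the other side. -/
theorem altChain_or_polySep (e : ℕ) {S R : Finset ℝ} (hd : Disjoint S R) :
    AltChain (e + 2) S R ∨ AltChain (e + 2) R S ∨ PolySep e S R := by
  by_cases h1 : AltChain (e + 1) S R
  swap
  · exact .inr (.inr (polySep_of_not_altChain_succ e S R hd h1))
  by_cases h2 : AltChain (e + 1) R S
  swap
  · exact .inr (.inr (polySep_of_not_altChain_succ e R S hd.symm h2).symm)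
  have hS : S.Nonempty := by
    obtain ⟨x, -, hx⟩ := h1
    exact ⟨x 0, by simpa using hx 0 (by omega)⟩
  have hR : R.Nonempty := by
    obtain ⟨x, -, hx⟩ := h2
    exact ⟨x 0, by simpa using hx 0 (by omega)⟩
  rcases lt_trichotomy (S.max' hS) (R.max' hR) with h | h | h
  · exact .inr (.inl (h1.cons (R.max'_mem hR) subset_rfl
      (fun r hr => (S.le_max' r hr).trans_lt h) fun y hy _ => hy))
  · exact absurd (R.max'_mem hR) (Finset.disjoint_left.mp hd (h ▸ S.max'_mem hS))
  · exact .inl (h2.cons (S.max'_mem hS) subset_rfl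
      (fun r hr => (R.le_max' r hr).trans_lt h) fun y hy _ => hy)

/-! ### Reduction to cells of the line. -/

/-- The alternation of `S` and `R` depends on `R` only through the cells it meets, as long as
those cells avoid `S`. -/
theorem AltChain.transfer {k : ℕ} {S R R' : Finset ℝ} {c : ℝ → ℕ} (hc : Monotone c)
    (hRR : R.image c ⊆ R'.image c) (hSR : Disjoint (S.image c) (R.image c)) {U V U' V' : Finset ℝ}
    (hUV : (U = S ∧ V = R ∧ U' = S ∧ V' = R') ∨ (U = R ∧ V = S ∧ U' = R' ∧ V' = S))
    (h : AltChain k U V) : AltChain k U' V' := by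
  obtain ⟨x, hx, hmem⟩ := h
  have hrep : ∀ r, ∃ r', c r' = c r ∧ (r ∈ R → r' ∈ R') := by
    intro r
    by_cases hr : r ∈ R
    · obtain ⟨r', h1, h2⟩ := Finset.mem_image.mp (hRR (Finset.mem_image_of_mem c hr))
      exact ⟨r', h2, fun _ => h1⟩
    · exact ⟨r, rfl, fun h => absurd h hr⟩
  choose g hg1 hg2 using hrep
  classical
  let f : ℝ → ℝ := fun y => if y ∈ R then g y else y
  have hfc : ∀ y, c (f y) = c y := fun y => by
    by_cases hy : y ∈ R <;> simp [f, hy, hg1]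
  have hfR : ∀ y ∈ R, f y ∈ R' := fun y hy => by simpa [f, hy] using hg2 y hy
  have hfS : ∀ y ∈ S, f y ∈ S := fun y hy => by
    have : y ∉ R := fun hyR => Finset.disjoint_left.mp hSR (Finset.mem_image_of_mem c hy)
      (Finset.mem_image_of_mem c hyR)
    simpa [f, this] using hy
  have hne : ∀ y ∈ S, ∀ z ∈ R, c y ≠ c z := fun y hy z hz h =>
    Finset.disjoint_left.mp hSR (Finset.mem_image_of_mem c hy) (h ▸ Finset.mem_image_of_mem c hz)
  refine ⟨fun i => f (x i), fun i hi => ?_, fun i hi => ?_⟩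
  -- A failure of strict decrease after the replacement would put neighbouring points of the chain,
  -- one in `S` and one in `R`, into the same cell.
  · by_contra hle
    have h1 := hc (not_lt.mp hle)
    rw [hfc, hfc] at h1
    have h2 := h1.antisymm (hc (hx i hi).le)
    have h3 := hmem i (by omega)
    have h4 := hmem (i + 1) hi
    by_cases hev : Even i
    · rw [if_pos hev] at h3
      rw [if_neg (by simpa [Nat.even_add_one] using hev)] at h4
      rcases hUV with ⟨rfl, rfl, -, -⟩ | ⟨rfl, rfl, -, -⟩
      · exact hne _ h3 _ h4 h2
      · exact hne _ h4 _ h3 h2.symm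
    · rw [if_neg hev] at h3
      rw [if_pos (by simpa [Nat.even_add_one] using hev)] at h4
      rcases hUV with ⟨rfl, rfl, -, -⟩ | ⟨rfl, rfl, -, -⟩
      · exact hne _ h4 _ h3 h2.symm
      · exact hne _ h3 _ h4 h2
  · have h3 := hmem i hi
    rcases hUV with ⟨rfl, rfl, rfl, rfl⟩ | ⟨rfl, rfl, rfl, rfl⟩ <;> split_ifs at h3 ⊢ <;> aesop

theorem PolySep.transfer {e : ℕ} {S R R' : Finset ℝ} {c : ℝ → ℕ} (hc : Monotone c)
    (hRR : R.image c = R'.image c) (hSR : Disjoint (S.image c) (R.image c))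
    (h : PolySep e S R') : PolySep e S R := by
  have hd : Disjoint S R := Finset.disjoint_left.mpr fun x hx hy =>
    Finset.disjoint_left.mp hSR (Finset.mem_image_of_mem c hx) (Finset.mem_image_of_mem c hy)
  rcases altChain_or_polySep e hd with h1 | h1 | h1
  · exact absurd h (h1.transfer hc hRR.subset hSR (.inl ⟨rfl, rfl, rfl, rfl⟩)).not_polySep
  · exact absurd h.symm (h1.transfer hc hRR.subset hSR (.inr ⟨rfl, rfl, rfl, rfl⟩)).not_polySep
  · exact h1

/-- Running down the common cells and picking from `R` and `R'` in turn gives a chain of length `e +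
2`. -/
theorem not_polySep_of_common_cells {e : ℕ} {R R' : Finset ℝ} {c : ℝ → ℕ} (hc : Monotone c)
    {T : Finset ℕ} (hT : T.card = e + 2) (hR : T ⊆ R.image c) (hR' : T ⊆ R'.image c) :
    ¬ PolySep e R R' := by
  have h1 : ∀ t ∈ T, ∃ x ∈ R, c x = t := fun t ht => Finset.mem_image.mp (hR ht)
  have h2 : ∀ t ∈ T, ∃ x ∈ R', c x = t := fun t ht => Finset.mem_image.mp (hR' ht)
  choose! f hf1 hf2 using h1
  choose! g hg1 hg2 using h2
  let o := T.orderEmbOfFin hT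
  -- The elements of `T` in decreasing order; the reduction modulo `e + 2` in `Fin.ofNat` is
  -- harmless for the indices in use.
  let q : ℕ → ℕ := fun i => o (Fin.ofNat (e + 2) i).rev
  have hqT : ∀ i, q i ∈ T := fun i => T.orderEmbOfFin_mem hT _
  have hq : ∀ i, i + 1 < e + 2 → q (i + 1) < q i := by
    intro i hi
    refine o.strictMono ?_
    rw [Fin.rev_lt_rev, Fin.lt_def]
    simp [Fin.ofNat, Nat.mod_eq_of_lt hi, Nat.mod_eq_of_lt (by omega : i < e + 2)]
  refine AltChain.not_polySep
    ⟨fun i => if Even i then f (q i) else g (q i), fun i hi => ?_, fun i hi => ?_⟩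
  · have hcq : ∀ i, c (if Even i then f (q i) else g (q i)) = q i := fun i => by
      split_ifs
      · exact hf2 _ (hqT i)
      · exact hg2 _ (hqT i)
    by_contra hle
    have := hc (not_lt.mp hle)
    rw [hcq, hcq] at this
    exact absurd this (not_le.mpr (hq i hi))
  · dsimp only
    split_ifs
    · exact hf1 _ (hqT i)
    · exact hg1 _ (hqT i)

/-- Pairwise separated families of sets are cut apart by few points of the line. -/
theorem exists_cells {e m : ℕ} (X : Fin m → Finset ℝ)
    (hX : ∀ a a', a ≠ a' → PolySep e (X a) (X a')) :
    ∃ c : ℝ → ℕ, Monotone c ∧ (∀ x, c x < m * m * e + 1) ∧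
      ∀ a a', ∀ x ∈ X a, ∀ x' ∈ X a', c x = c x' → a = a' := by
  have hX' : ∀ q : Fin m × Fin m, ∃ p : Polynomial ℝ, p.natDegree ≤ e ∧ (q.1 ≠ q.2 →
      (∀ x ∈ X q.1, 0 < p.eval x) ∧ ∀ x ∈ X q.2, p.eval x < 0) := by
    intro q
    by_cases hq : q.1 = q.2
    · exact ⟨0, by simp, fun h => absurd hq h⟩
    · obtain ⟨p, h1, h2⟩ := hX _ _ hq
      exact ⟨p, h1, fun _ => h2⟩
  choose p hdeg hp using hX'
  -- All roots of all separating polynomials; the cell of a point is the number of these roots to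
  -- its left. The default `0` on the diagonal contributes none.
  let Z : Finset ℝ := Finset.univ.biUnion fun q => (p q).roots.toFinset
  have hZ : Z.card ≤ m * m * e := by
    refine (Finset.card_biUnion_le_card_mul _ _ e fun q _ => ?_).trans (by simp)
    exact (Multiset.toFinset_card_le _).trans ((p q).card_roots'.trans (hdeg q))
  let c : ℝ → ℕ := fun x => (Z.filter (· < x)).card
  have hmono : Monotone c := fun x y hxy => Finset.card_le_card fun z hz => by
    rw [Finset.mem_filter] at hz ⊢
    exact ⟨hz.1, hz.2.trans_le hxy⟩
  have hlt : ∀ x y z, z ∈ Z → x < z → z < y → c x < c y := by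
    intro x y z hz hxz hzy
    refine Finset.card_lt_card (Finset.ssubset_iff_of_subset ?_ |>.mpr ⟨z, ?_, ?_⟩)
    · intro w hw
      rw [Finset.mem_filter] at hw ⊢
      exact ⟨hw.1, hw.2.trans (hxz.trans hzy)⟩
    · exact Finset.mem_filter.mpr ⟨hz, hzy⟩
    · simp [hxz.le]
  refine ⟨c, hmono, fun x => Nat.lt_succ_of_le ((Finset.card_filter_le _ _).trans hZ), ?_⟩
  intro a a' x hx x' hx' hcc
  by_contra hne
  obtain ⟨h1, h2⟩ := hp (a, a') hne
  have h1 := h1 x hx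
  have h2 := h2 x' hx'
  have hp0 : p (a, a') ≠ 0 := fun h => by simp [h] at h1
  have hmem : ∀ z, (p (a, a')).IsRoot z → z ∈ Z := fun z hz =>
    Finset.mem_biUnion.mpr ⟨(a, a'), Finset.mem_univ _, by simpa [hp0] using hz⟩
  rcases lt_trichotomy x x' with h | h | h
  · obtain ⟨z, hz1, hz2, hz⟩ := exists_root_between h (mul_neg_of_pos_of_neg h1 h2)
    exact absurd hcc (hlt _ _ z (hmem z hz) hz1 hz2).ne
  · rw [h] at h1
    exact lt_asymm h1 h2
  · obtain ⟨z, hz1, hz2, hz⟩ := exists_root_between h (mul_neg_of_neg_of_pos h2 h1)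
    exact absurd hcc (hlt _ _ z (hmem z hz) hz1 hz2).ne'

/-! ### Counting the codes of subsets. -/

theorem card_filter_powerset_card_le (L k : ℕ) (hL : 1 ≤ L) :
    ((Finset.range L).powerset.filter fun T => T.card ≤ k).card ≤ (k + 1) * L ^ k := by
  have hsub : ((Finset.range L).powerset.filter fun T => T.card ≤ k) ⊆
      (Finset.range (k + 1)).biUnion fun i => (Finset.range L).powersetCard i := by
    intro T hT
    simp only [Finset.mem_filter, Finset.mem_powerset] at hT
    simp only [Finset.mem_biUnion, Finset.mem_range, Finset.mem_powersetCard]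
    exact ⟨_, Nat.lt_succ_of_le hT.2, hT.1, rfl⟩
  refine (Finset.card_le_card hsub).trans
    ((Finset.card_biUnion_le_card_mul _ _ (L ^ k) fun i hi => ?_).trans (by simp))
  rw [Finset.card_powersetCard, Finset.card_range]
  exact (Nat.choose_le_pow L i).trans
    (Nat.pow_le_pow_right hL (Nat.lt_succ_iff.mp (Finset.mem_range.mp hi)))

/-- Membership of elements of `Fin m` in all subsets of `Fin m` is not the intersection pattern of
sets of reals with respect to separation by polynomials of bounded degree, if `m` is large. -/
theorem two_pow_le_of_incidence {e m : ℕ} (X : Fin m → Finset ℝ) (Y : Finset (Fin m) → Finset ℝ)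
    (hX : ∀ a a', a ≠ a' → PolySep e (X a) (X a'))
    (hY : ∀ b b', b ≠ b' → PolySep e (Y b) (Y b'))
    (hXY : ∀ a b, a ∈ b ↔ ¬ PolySep e (X a) (Y b)) :
    2 ^ m ≤ ((e + 3) * (m * m * e + 1) ^ (e + 2)) ^ 2 := by
  classical
  obtain ⟨c, hc, hcL, hcX⟩ := exists_cells X hX
  -- `T b` is the set of cells met by `Y b`, cut down to `e + 2` of them if there are more.
  have hT : ∀ b, ∃ T ⊆ (Y b).image c, T.card ≤ e + 2 ∧ (T.card ≠ e + 2 → T = (Y b).image c) := by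
    intro b
    by_cases h : e + 2 ≤ ((Y b).image c).card
    · obtain ⟨T, h1, h2⟩ := Finset.exists_subset_card_eq h
      exact ⟨T, h1, h2.le, fun h => absurd h2 h⟩
    · exact ⟨_, subset_rfl, by omega, fun _ => rfl⟩
  choose T hT1 hT2 hT3 using hT
  -- A cell meets at most one `X a`, so marking the cells of `T b` met by members of `b` decides
  -- membership for every `a` whose set meets `T b`.
  let U : Finset (Fin m) → Finset ℕ := fun b => (T b).filter fun t => ∃ a ∈ b, ∃ x ∈ X a, c x = t
  let W := (Finset.range (m * m * e + 1)).powerset.filter fun T => T.card ≤ e + 2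
  have hTW : ∀ b, T b ∈ W := fun b => by
    refine Finset.mem_filter.mpr ⟨Finset.mem_powerset.mpr fun t ht => ?_, hT2 b⟩
    obtain ⟨x, -, rfl⟩ := Finset.mem_image.mp (hT1 b ht)
    exact Finset.mem_range.mpr (hcL x)
  have hUW : ∀ b, U b ∈ W := fun b => by
    have h := Finset.mem_filter.mp (hTW b)
    have hs : U b ⊆ T b := Finset.filter_subset _ _
    exact Finset.mem_filter.mpr ⟨Finset.mem_powerset.mpr (hs.trans (Finset.mem_powerset.mp h.1)),
      (Finset.card_le_card hs).trans h.2⟩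
  have hsub : ∀ b b', T b = T b' → U b = U b' → (T b).card ≠ e + 2 → b ⊆ b' := by
    intro b b' hTT hUU hcard a ha
    have hb := hT3 b hcard
    have hb' := hT3 b' (hTT ▸ hcard)
    -- If `X a` avoids the cells of `Y b`, separability depends only on those cells, which `b` and
    -- `b'` share. Otherwise a shared cell identifies `a` and its mark in `U` decides.
    by_cases hE : Disjoint ((X a).image c) (T b)
    · by_contra ha'
      have hs : PolySep e (X a) (Y b') := by
        by_contra h
        exact ha' ((hXY a b').mpr h)
      exact (hXY a b).mp ha (hs.transfer hc (by rw [← hb, ← hb', hTT]) (hb ▸ hE))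
    · obtain ⟨t, ht1, ht2⟩ := Finset.not_disjoint_iff.mp hE
      obtain ⟨x, hx, rfl⟩ := Finset.mem_image.mp ht1
      have hU : c x ∈ U b := Finset.mem_filter.mpr ⟨ht2, a, ha, x, hx, rfl⟩
      rw [hUU] at hU
      obtain ⟨-, a', ha', x', hx', hxx⟩ := Finset.mem_filter.mp hU
      rwa [hcX a a' x hx x' hx' hxx.symm]
  have hinj : Function.Injective fun b => (T b, U b) := by
    intro b b' h
    obtain ⟨hTT, hUU⟩ := Prod.mk.inj h
    -- A full code cannot be shared: `e + 2` common cells would prevent `Y b` and `Y b'` from being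
    -- separated.
    by_cases hcard : (T b).card = e + 2
    · by_contra hne
      exact not_polySep_of_common_cells hc hcard (hT1 b) (hTT ▸ hT1 b') (hY b b' hne)
    · exact (hsub b b' hTT hUU hcard).antisymm
        (hsub b' b hTT.symm hUU.symm (hTT ▸ hcard))
  have hcard : (Finset.univ : Finset (Finset (Fin m))).card ≤ (W ×ˢ W).card :=
    Finset.card_le_card_of_injOn _ (fun b _ => Finset.mem_coe.mpr
      (Finset.mem_product.mpr ⟨hTW b, hUW b⟩)) hinj.injOn
  rw [Finset.card_univ, Fintype.card_finset, Fintype.card_fin, Finset.card_product] at hcard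
  have hW : W.card ≤ (e + 3) * (m * m * e + 1) ^ (e + 2) :=
    card_filter_powerset_card_le _ _ (by omega)
  calc 2 ^ m ≤ W.card * W.card := hcard
    _ ≤ _ := by rw [sq]; exact Nat.mul_le_mul hW hW

theorem exists_pow_lt_two_pow (d : ℕ) :
    ∃ m, ∀ e ≤ d, ((e + 3) * (m * m * e + 1) ^ (e + 2)) ^ 2 < 2 ^ m := by
  -- The bound is a constant times a power of `m`: `m ^ 2` to the power `d + 2`, then squared. One
  -- `m` serves all `e ≤ d`, which is why one graph serves all dimensions.
  set k := 2 * (2 * (d + 2)) with hk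
  set K := ((d + 3) * (d + 1) ^ (d + 2)) ^ 2 with hK
  have hlim := tendsto_pow_const_div_const_pow_of_one_lt k (one_lt_two : (1 : ℝ) < 2)
  have hev := hlim.eventually (gt_mem_nhds (by positivity : (0 : ℝ) < 1 / ((K : ℝ) + 1)))
  obtain ⟨m, hm, hm1⟩ := (hev.and (Filter.eventually_ge_atTop 1)).exists
  refine ⟨m, fun e he => ?_⟩
  have hlt : K * m ^ k < 2 ^ m := by
    rw [div_lt_div_iff₀ (by positivity) (by positivity), one_mul] at hm
    have h2 : (K : ℝ) * m ^ k ≤ m ^ k * (K + 1) := by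
      nlinarith [pow_nonneg (Nat.cast_nonneg (α := ℝ) m) k]
    exact_mod_cast h2.trans_lt hm
  refine lt_of_le_of_lt ?_ hlt
  have h1 : m * m * e + 1 ≤ (d + 1) * m ^ 2 := by nlinarith [Nat.mul_le_mul_left (m * m) he]
  have hpos : 1 ≤ (d + 1) * m ^ 2 := by nlinarith
  calc ((e + 3) * (m * m * e + 1) ^ (e + 2)) ^ 2
      ≤ ((d + 3) * ((d + 1) * m ^ 2) ^ (d + 2)) ^ 2 := by
        gcongr ?_ ^ 2
        refine Nat.mul_le_mul (by omega) ((Nat.pow_le_pow_left h1 _).trans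
          (Nat.pow_le_pow_right hpos (by omega)))
    _ = K * m ^ k := by rw [hK, hk, mul_pow (d + 1), ← pow_mul m]; ring

/-! ### The moment curve: general position and disjoint hulls. -/

/-- The point of the moment curve in `ℝ^d` with parameter `t`. -/
def momentCurve (d : ℕ) (t : ℝ) : Pt d := WithLp.toLp 2 fun i => t ^ ((i : ℕ) + 1)

theorem eval_eq_sum_momentCurve {d : ℕ} {p : Polynomial ℝ} (hp : p.natDegree ≤ d) (t : ℝ) :
    p.eval t = p.coeff 0 + ∑ i : Fin d, p.coeff (i + 1) * momentCurve d t i := by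
  rw [Polynomial.eval_eq_sum_range' (Nat.lt_succ_of_le hp), Finset.sum_range_succ', add_comm,
    Finset.sum_range fun i => p.coeff (i + 1) * t ^ (i + 1)]
  simp [momentCurve]

theorem momentCurve_injective {d : ℕ} (hd : 1 ≤ d) : Function.Injective (momentCurve d) := by
  intro s t h
  have := congrArg (fun v : Pt d => v ⟨0, hd⟩) h
  simpa [momentCurve] using this

/-- An affine dependence annihilates every polynomial of degree at most `d`; testing it on a
Lagrange basis polynomial of `S` isolates a single weight. -/
theorem affineIndependent_momentCurve {d : ℕ} (S : Finset ℝ) (hS : S.card ≤ d + 1) :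
    AffineIndependent ℝ fun t : S => momentCurve d t := by
  rw [affineIndependent_iff]
  intro s w hw hsum a ha
  set p := Lagrange.basis S id (a : ℝ) with hp
  have hdeg : p.natDegree ≤ d := by
    have := Lagrange.degree_basis (v := id) (s := S) Function.injective_id.injOn a.2
    rw [Polynomial.natDegree_eq_of_degree_eq_some this]
    omega
  have hzero : ∑ t ∈ s, w t * p.eval (t : ℝ) = 0 := by
    have hcoord : ∀ i : Fin d, ∑ t ∈ s, w t * momentCurve d t i = 0 := fun i => by
      have := congrArg (fun v : Pt d => v i) hsum
      simpa using this
    calc ∑ t ∈ s, w t * p.eval (t : ℝ)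
        = p.coeff 0 * ∑ t ∈ s, w t +
          ∑ i : Fin d, p.coeff (i + 1) * ∑ t ∈ s, w t * momentCurve d t i := by
          simp_rw [eval_eq_sum_momentCurve hdeg, mul_add, Finset.sum_add_distrib, Finset.mul_sum]
          rw [Finset.sum_comm]
          congr 1
          · exact Finset.sum_congr rfl fun _ _ => mul_comm _ _
          · exact Finset.sum_congr rfl fun _ _ => Finset.sum_congr rfl fun _ _ => by ring
      _ = 0 := by simp [hw, hcoord]
  rw [Finset.sum_eq_single_of_mem a ha fun t _ hta => ?_] at hzero
  · have h1 : p.eval (a : ℝ) = 1 :=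
      Lagrange.eval_basis_self (v := id) (s := S) Function.injective_id.injOn a.2
    simpa [h1] using hzero
  · have h0 : p.eval (t : ℝ) = 0 :=
      Lagrange.eval_basis_of_ne (v := id) (s := S) (fun h => hta (Subtype.ext h.symm)) t.2
    rw [h0, mul_zero]

theorem inGeneralPosition_image_momentCurve {d : ℕ} (hd : 1 ≤ d) (N : Finset ℝ) :
    InGeneralPosition (N.image (momentCurve d)) := by
  rintro k hk S hS hcard ⟨L, hL, hSL⟩
  obtain ⟨T, hTN, rfl⟩ := Finset.subset_image_iff.mp hS
  rw [Finset.card_image_of_injective _ (momentCurve_injective hd)] at hcard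
  have hai := affineIndependent_momentCurve (d := d) T (by omega)
  have hfin := hai.finrank_vectorSpan (n := k - 1) (by rw [Fintype.card_coe]; omega)
  have hle : vectorSpan ℝ (Set.range fun t : T => momentCurve d t) ≤ L.direction := by
    rw [AffineSubspace.direction]
    refine vectorSpan_mono ℝ ?_
    rintro _ ⟨t, rfl⟩
    exact hSL (by simpa using ⟨t, t.2, rfl⟩)
  have := Submodule.finrank_mono hle
  omega

/-- The coefficients of a polynomial are a linear functional plus a constant, so polynomials of
degree at most `d` correspond to affine hyperplanes; Hahn–Banach supplies one when the hulls are
disjoint. -/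
theorem not_inter_convexHull_nonempty_iff_polySep {d : ℕ} (S R : Finset ℝ) :
    ¬ (convexHull ℝ (S.image (momentCurve d) : Set (Pt d)) ∩
      convexHull ℝ (R.image (momentCurve d) : Set (Pt d))).Nonempty ↔ PolySep d S R := by
  constructor
  · intro h
    obtain ⟨f, u, v, hu, huv, hv⟩ := geometric_hahn_banach_compact_closed
      (convex_convexHull ℝ _) ((R.image (momentCurve d)).finite_toSet.isCompact_convexHull ℝ)
      (convex_convexHull ℝ _) ((S.image (momentCurve d)).finite_toSet.isClosed_convexHull ℝ)
      (Set.disjoint_iff_inter_eq_empty.mpr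
        (Set.inter_comm _ _ ▸ Set.not_nonempty_iff_eq_empty.mp h))
    let p : Polynomial ℝ := ∑ i : Fin d,
      Polynomial.C (f (EuclideanSpace.single i 1)) * Polynomial.X ^ ((i : ℕ) + 1) - Polynomial.C u
    have hp : ∀ t, p.eval t = f (momentCurve d t) - u := by
      intro t
      have hsum : momentCurve d t =
          ∑ i : Fin d, t ^ ((i : ℕ) + 1) • EuclideanSpace.single i (1 : ℝ) := by
        ext j
        simp [momentCurve, Pi.single_apply]
      rw [hsum, map_sum]
      simp only [p, Polynomial.eval_sub, Polynomial.eval_finsetSum, Polynomial.eval_mul,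
        Polynomial.eval_C, Polynomial.eval_pow, Polynomial.eval_X, map_smul, smul_eq_mul]
      simp only [mul_comm]
    have hdeg : p.natDegree ≤ d := by
      refine (Polynomial.natDegree_sub_le _ _).trans (max_le ?_ (by simp))
      refine Polynomial.natDegree_sum_le_of_forall_le _ _ fun i _ => ?_
      exact (Polynomial.natDegree_C_mul_X_pow_le _ _).trans i.2
    refine ⟨p, hdeg, fun x hx => ?_, fun x hx => ?_⟩
    · have := hv _ (subset_convexHull ℝ _ (Finset.mem_coe.mpr (Finset.mem_image_of_mem _ hx)))
      rw [hp]
      linarith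
    · have := hu _ (subset_convexHull ℝ _ (Finset.mem_coe.mpr (Finset.mem_image_of_mem _ hx)))
      rw [hp]
      linarith
  · rintro ⟨p, hdeg, hS, hR⟩ ⟨y, hyS, hyR⟩
    have hlin : IsLinearMap ℝ fun v : Pt d => ∑ i : Fin d, p.coeff (i + 1) * v i :=
      ⟨fun v w => by simp [mul_add, Finset.sum_add_distrib],
        fun a v => by simp [Finset.mul_sum, mul_left_comm]⟩
    have h1 := convexHull_min (t := {v : Pt d | -p.coeff 0 < ∑ i : Fin d, p.coeff (i + 1) * v i})
      (fun v hv => by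
        obtain ⟨x, hx, rfl⟩ := Finset.mem_image.mp (Finset.mem_coe.mp hv)
        have := hS x hx
        rw [eval_eq_sum_momentCurve hdeg] at this
        exact neg_lt_iff_pos_add'.mpr this) (convex_halfSpace_gt hlin _) hyS
    have h2 := convexHull_min (t := {v : Pt d | ∑ i : Fin d, p.coeff (i + 1) * v i < -p.coeff 0})
      (fun v hv => by
        obtain ⟨x, hx, rfl⟩ := Finset.mem_image.mp (Finset.mem_coe.mp hv)
        have := hR x hx
        rw [eval_eq_sum_momentCurve hdeg] at this
        exact lt_neg_iff_add_neg'.mpr this) (convex_halfSpace_lt hlin _) hyR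
    rw [Set.mem_ofPred_eq] at h1 h2
    exact lt_asymm h1 h2

/-! ### From induced graphs to separation patterns, and the conclusion. -/

theorem pair_mem_graphComplex {n : ℕ} (G : SimpleGraph (Fin n)) {i j : Fin n} (hij : i ≠ j) :
    {i, j} ∈ graphComplex G ↔ G.Adj i j := by
  change ({i, j} : Finset (Fin n)).card ≤ 2 ∧ G.IsClique _ ↔ _
  simp [Finset.card_pair hij, hij]

theorem IsPartitionInduced.exists_polySep {n d : ℕ} {G : SimpleGraph (Fin n)} {N : Finset ℝ}
    {P : Finset (Pt d)} (hP : P ⊆ N.image (momentCurve d))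
    (h : IsPartitionInduced (graphComplex G) P) :
    ∃ X : Fin n → Finset ℝ, ∀ i j, i ≠ j → (G.Adj i j ↔ ¬ PolySep d (X i) (X j)) := by
  obtain ⟨Q, -, hQP, hQ⟩ := h
  have hX : ∀ i, ∃ X : Finset ℝ, X.image (momentCurve d) = Q i := fun i => by
    obtain ⟨X, -, hX⟩ := Finset.subset_image_iff.mp
      (show Q i ⊆ N.image (momentCurve d) from fun x hx => hP ((hQP x).mpr ⟨i, hx⟩))
    exact ⟨X, hX⟩
  choose X hX using hX
  refine ⟨X, fun i j hij => ?_⟩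
  rw [← pair_mem_graphComplex G hij, hQ, ← not_inter_convexHull_nonempty_iff_polySep, not_not, hX, hX,
    Finset.set_biInter_insert, Finset.set_biInter_singleton]

theorem IsWeaklyTverberg.exists_polySep {n d : ℕ} (hd : 1 ≤ d) {G : SimpleGraph (Fin n)}
    (h : IsWeaklyTverberg d (graphComplex G)) :
    ∃ X : Fin n → Finset ℝ, ∀ i j, i ≠ j → (G.Adj i j ↔ ¬ PolySep d (X i) (X j)) := by
  obtain ⟨C, hC⟩ := h
  -- Any `C` distinct parameters would do. Every subset of the resulting points still lies on the
  -- curve, so the weak property is refuted as well.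
  let N : Finset ℝ := (Finset.range C).image (Nat.cast : ℕ → ℝ)
  obtain ⟨P, hP, hPG⟩ := hC _ (inGeneralPosition_image_momentCurve hd N) (by
    rw [Finset.card_image_of_injective _ (momentCurve_injective hd),
      Finset.card_image_of_injective _ Nat.cast_injective, Finset.card_range])
  exact hPG.exists_polySep hP

theorem IsTverberg.isWeaklyTverberg {n d : ℕ} {Δ : SetComplex n} (h : IsTverberg d Δ) :
    IsWeaklyTverberg d Δ := by
  obtain ⟨C, hC⟩ := h
  exact ⟨C, fun P hP hcard => ⟨P, subset_rfl, hC P hP hcard⟩⟩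

/-- The bipartite incidence graph between the elements and the subsets of `Fin m`. -/
def incidenceGraph (m : ℕ) : SimpleGraph (Fin m ⊕ Finset (Fin m)) :=
  SimpleGraph.fromRel fun v w => ∃ a b, v = .inl a ∧ w = .inr b ∧ a ∈ b

theorem theorem1 (d : ℕ) (hd : 1 ≤ d) :
    ∃ (n : ℕ) (G : SimpleGraph (Fin n)), ∀ d' : ℕ, 1 ≤ d' → d' ≤ d →
      ¬ IsTverberg d' (graphComplex G) ∧ ¬ IsWeaklyTverberg d' (graphComplex G) := by
  obtain ⟨m, hm⟩ := exists_pow_lt_two_pow d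
  let φ := Fintype.equivFin (Fin m ⊕ Finset (Fin m))
  refine ⟨_, (incidenceGraph m).comap φ.symm, fun e he1 hed => ?_⟩
  have hweak : ¬ IsWeaklyTverberg e (graphComplex ((incidenceGraph m).comap φ.symm)) := by
    intro h
    obtain ⟨X, hX⟩ := h.exists_polySep he1
    have hX' : ∀ v w, v ≠ w →
        ((incidenceGraph m).Adj v w ↔ ¬ PolySep e (X (φ v)) (X (φ w))) := fun v w hvw => by
      rw [← hX _ _ (φ.injective.ne hvw)]
      simp
    refine absurd (two_pow_le_of_incidence (e := e) (fun a => X (φ (.inl a)))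
      (fun b => X (φ (.inr b))) (fun a a' ha => ?_) (fun b b' hb => ?_) fun a b => ?_)
      (not_le.mpr (hm e hed))
    · have := hX' (.inl a) (.inl a') (by simpa using ha)
      by_contra hs
      simpa [incidenceGraph] using this.mpr hs
    · have := hX' (.inr b) (.inr b') (by simpa using hb)
      by_contra hs
      simpa [incidenceGraph] using this.mpr hs
    · rw [← hX' _ _ (by simp)]
      simp [incidenceGraph]
  exact ⟨fun h => hweak h.isWeaklyTverberg, hweak⟩
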